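/- Let $n\ge 4$. The degree partition of a simple graph on $n$ vertices is its degree sequence arranged in weakly decreasing order (zero entries are kept); let $\mathsf{DP}(n)\subset\mathbb{R}^n$ be the convex hull of all degree partitions of simple graphs on $n$ vertices. For integers $k,l\ge 0$ with $1\le k+l\le n$, consider the Fulkerson--Hoffman--McAndrew (FHM) inequality $$\sum_{i=1}^{k} x_i-\sum_{i=n-l+1}^{n} x_i\ \le\ k(n-1-l).\qquad (\ast_{k,l})$$ The inequalities $x_i\ge x_{i+1}$ ($1\le i\le n-1$) and all the inequalities $(\ast_{k,l})$ are valid on $\mathsf{DP}(n)$, and the facets of $\mathsf{DP}(n)$ (its nonempty faces of dimension $\dim\mathsf{DP}(n)-1$) are exactly the sets of points of $\mathsf{DP}(n)$ at which one of the following inequalities holds with equality: (i) $x_i\ge x_{i+1}$, for $i=1,\dots,n-1$; (ii) $(\ast_{k,l})$, where $(k,l)=(1,0)$, or $(k,l)=(0,1)$, or $k,l\neq 0$ and either $2\le k+l\le n-3$ or $k+l=n$. Moreover, among the inequalities $(\ast_{k,l})$ with $1\le k+l\le n$, exactly those listed in (ii) determine facets. Consequently, $\mathsf{DP}(n)$ has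 exactly $\frac{n(n-3)}{2}+6$ facets. -/

import Mathlib

noncomputable section

open Classical in
/-- The degree partitions of simple graphs on `n` vertices, as integer vectors: rearrangements
`i ↦ deg (σ i)` of a degree sequence that are weakly decreasing (zero entries are allowed). -/
def degreePartitions (n : ℕ) : Set (Fin n → ℕ) :=
  {d | Antitone d ∧ ∃ (G : SimpleGraph (Fin n)) (σ : Equiv.Perm (Fin n)),
    ∀ i, d i = G.degree (σ i)}

/-- The polytope of degree partitions: the convex hull in `ℝⁿ` of all degree partitions. -/
def degreePartitionPolytope (n : ℕ) : Set (Fin n → ℝ) :=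
  convexHull ℝ ((fun (d : Fin n → ℕ) (i : Fin n) => (d i : ℝ)) '' degreePartitions n)

/-- The dimension of the affine span of a nonempty set in `ℝⁿ`. -/
def affineDim {n : ℕ} (P : Set (Fin n → ℝ)) : ℕ :=
  Module.finrank ℝ (vectorSpan ℝ P)

/-- `F` is a facet of the polytope `P`: a nonempty face (the set of maximizers over `P` of a linear
functional) whose dimension is one less than that of `P`. -/
def IsFacet {n : ℕ} (P F : Set (Fin n → ℝ)) : Prop :=
  IsExposed ℝ P F ∧ F.Nonempty ∧ affineDim F + 1 = affineDim P

/-- The left side `x₁ + ⋯ + x_k - (x_{n-l+1} + ⋯ + x_n)` of the Fulkerson-Hoffman-McAndrew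
inequality. The coordinates are indexed from `0` here. -/
def fhmLhs (n k l : ℕ) (x : Fin n → ℝ) : ℝ :=
  (∑ i ∈ Finset.univ.filter (fun i : Fin n => (i : ℕ) < k), x i) -
    ∑ i ∈ Finset.univ.filter (fun i : Fin n => n ≤ (i : ℕ) + l), x i

/-- The right side `k (n - 1 - l)` of the Fulkerson-Hoffman-McAndrew inequality. -/
def fhmRhs (n k l : ℕ) : ℝ := (k : ℝ) * ((n : ℝ) - 1 - (l : ℝ))

/-- The pairs `(k, l)` that are listed: `(1, 0)`, `(0, 1)`, and those with `k, l ≠ 0` and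
`k + l ∈ {2, …, n - 3, n}`. -/
def FacetPair (n k l : ℕ) : Prop :=
  (k = 1 ∧ l = 0) ∨ (k = 0 ∧ l = 1) ∨
    (k ≠ 0 ∧ l ≠ 0 ∧ ((2 ≤ k + l ∧ k + l ≤ n - 3) ∨ k + l = n))

end

/-!
A linear functional `c` is maximized over all degree sequences by any graph that contains the pairs
`uv` with `c u + c v > 0` and avoids those with `c u + c v < 0`. If `c` is antitone, such a graph
can be chosen with antitone degrees, so the maximum over the polytope is the sum of
`max 0 (c u + c v)` over the pairs `uv`. This sum is piecewise linear in `c`: the face maximizing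
`c` is contained in the face maximizing `a` whenever every nonzero `a u + a v` has the same sign as
`c u + c v`. Taking for `a` the vector of signs of `c`, every face of an antitone `c ≠ 0` lies in
the face of a Fulkerson–Hoffman–McAndrew inequality. If `c` is not antitone, let `d` be its
projection to the cone of antitone vectors and `e = c - d`. The degrees of the threshold graph of
`d` have the same ties as `d`, so they are orthogonal to `e`; hence a maximizer of `c` is orthogonal
to `e` as well and satisfies `x i = x (i + 1)` for some `i`.

A face of a full-dimensional polytope is a facet exactly when the functionals constant on it form a
line. Switching an edge `uv` with `c u + c v = 0` on and off within the face of `c` shows that a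
functional `w` constant on this face has `w u + w v = 0`. For the listed pairs `(k, l)` this leaves
only multiples of the coefficient vector: the middle coordinates, if there are any, number at least
three, so all of them vanish. For the pairs not listed, the comparison of signs puts the face into
the face of another inequality.
-/

open Matrix

/-! ### Facets and the functionals constant on them -/

section Facets

section

variable {ι : Type*} [Fintype ι]

/-- The vectors `w` for which the linear functional `w ⬝ᵥ ·` is constant on `F`. Up to the choice
of coordinates this is the annihilator of the direction of the affine span of `F`, so its dimension
is the codimension of `F`. -/
def constFunctionals (F : Set (ι → ℝ)) : Submodule ℝ (ι → ℝ) where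
  carrier := {w | ∀ x ∈ F, ∀ y ∈ F, w ⬝ᵥ x = w ⬝ᵥ y}
  add_mem' := fun hv hw x hx y hy => by
    rw [add_dotProduct, add_dotProduct, hv x hx y hy, hw x hx y hy]
  zero_mem' := fun x _ y _ => by rw [zero_dotProduct, zero_dotProduct]
  smul_mem' := fun r w hw x hx y hy => by rw [smul_dotProduct, smul_dotProduct, hw x hx y hy]

theorem mem_constFunctionals {F : Set (ι → ℝ)} {w : ι → ℝ} :
    w ∈ constFunctionals F ↔ ∀ x ∈ F, ∀ y ∈ F, w ⬝ᵥ x = w ⬝ᵥ y :=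
  Iff.rfl

theorem constFunctionals_eq_comap_dualAnnihilator [DecidableEq ι] (F : Set (ι → ℝ)) :
    constFunctionals F =
      (vectorSpan ℝ F).dualAnnihilator.comap (dotProductEquiv ℝ ι).toLinearMap := by
  ext w
  have hker : w ∈ constFunctionals F ↔ vectorSpan ℝ F ≤ LinearMap.ker (dotProductEquiv ℝ ι w) := by
    rw [vectorSpan_def, Submodule.span_le, Set.vsub_subset_iff, mem_constFunctionals]
    simp only [SetLike.mem_coe, LinearMap.mem_ker, dotProductEquiv_apply_apply, vsub_eq_sub,
      dotProduct_sub, sub_eq_zero]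
  rw [hker, Submodule.mem_comap, Submodule.mem_dualAnnihilator]
  exact Iff.rfl

theorem finrank_vectorSpan_add_finrank_constFunctionals (F : Set (ι → ℝ)) :
    Module.finrank ℝ (vectorSpan ℝ F) + Module.finrank ℝ (constFunctionals F) =
      Fintype.card ι := by
  classical
  rw [constFunctionals_eq_comap_dualAnnihilator,
    ((dotProductEquiv ℝ ι).ofSubmodule' _).finrank_eq,
    Subspace.finrank_add_finrank_dualAnnihilator_eq, Module.finrank_fintype_fun_eq_card]

/-- The part of `P` on which the linear inequality `a ⬝ᵥ x ≤ b` is tight. -/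
def tightSet (P : Set (ι → ℝ)) (a : ι → ℝ) (b : ℝ) : Set (ι → ℝ) :=
  {x ∈ P | a ⬝ᵥ x = b}

theorem mem_constFunctionals_of_subset_tightSet {P F : Set (ι → ℝ)} {a : ι → ℝ} {b : ℝ}
    (h : F ⊆ tightSet P a b) : a ∈ constFunctionals F :=
  fun _ hx _ hy => (h hx).2.trans (h hy).2.symm

end

variable {n : ℕ} {P F : Set (Fin n → ℝ)} {a c : Fin n → ℝ} {b : ℝ}

theorem affineDim_add_finrank_constFunctionals (F : Set (Fin n → ℝ)) :
    affineDim F + Module.finrank ℝ (constFunctionals F) = n := by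
  rw [affineDim, finrank_vectorSpan_add_finrank_constFunctionals, Fintype.card_fin]

theorem affineDim_eq_of_constFunctionals_eq_bot (h : constFunctionals P = ⊥) :
    affineDim P = n := by
  have hdim := affineDim_add_finrank_constFunctionals P
  rwa [h, finrank_bot, add_zero] at hdim

theorem isExposed_tightSet (hab : ∀ x ∈ P, a ⬝ᵥ x ≤ b) : IsExposed ℝ P (tightSet P a b) := by
  rintro ⟨x₀, hx₀, hx₀b⟩
  refine ⟨LinearMap.toContinuousLinearMap (dotProductEquiv ℝ (Fin n) a), ?_⟩
  ext x
  simp only [tightSet, Set.mem_ofPred_eq, LinearMap.coe_toContinuousLinearMap',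
    dotProductEquiv_apply_apply]
  exact and_congr_right fun hx => ⟨fun h y hy => h ▸ hab y hy,
    fun h => (hab x hx).antisymm (hx₀b ▸ h x₀ hx₀)⟩

theorem isFacet_tightSet (hP : affineDim P = n) (ha : a ≠ 0) (hab : ∀ x ∈ P, a ⬝ᵥ x ≤ b)
    (hne : (tightSet P a b).Nonempty) (h : constFunctionals (tightSet P a b) ≤ ℝ ∙ a) :
    IsFacet P (tightSet P a b) := by
  refine ⟨isExposed_tightSet hab, hne, ?_⟩
  have hdim := affineDim_add_finrank_constFunctionals (tightSet P a b)
  have hspan : ℝ ∙ a ≤ constFunctionals (tightSet P a b) :=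
    (Submodule.span_singleton_le_iff_mem _ _).2 (mem_constFunctionals_of_subset_tightSet subset_rfl)
  rw [h.antisymm hspan, finrank_span_singleton ha] at hdim
  exact hdim.trans hP.symm

theorem IsFacet.constFunctionals_eq_span (hP : affineDim P = n) (hF : IsFacet P F) (ha : a ≠ 0)
    (haF : a ∈ constFunctionals F) : constFunctionals F = ℝ ∙ a := by
  have hdim := affineDim_add_finrank_constFunctionals F
  have hcodim := hF.2.2
  refine (Submodule.eq_of_le_of_finrank_eq
    ((Submodule.span_singleton_le_iff_mem _ _).2 haF) ?_).symm
  rw [finrank_span_singleton ha]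
  lia

theorem IsFacet.exists_functional (hF : IsFacet P F) :
    ∃ c : Fin n → ℝ, c ≠ 0 ∧ F = {x ∈ P | ∀ y ∈ P, c ⬝ᵥ y ≤ c ⬝ᵥ x} := by
  obtain ⟨f, hf⟩ := hF.1 hF.2.1
  obtain ⟨c, hc⟩ := (dotProductEquiv ℝ (Fin n)).surjective (f : (Fin n → ℝ) →ₗ[ℝ] ℝ)
  have hfc (x : Fin n → ℝ) : f x = c ⬝ᵥ x := (LinearMap.congr_fun hc x).symm
  simp only [hfc] at hf
  refine ⟨c, ?_, hf⟩
  rintro rfl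
  have hFP : F = P := by simpa using hf
  have hcodim := hF.2.2
  rw [hFP] at hcodim
  lia

theorem IsFacet.eq_tightSet_of_subset (hP : affineDim P = n) (hF : IsFacet P F) (ha : a ≠ 0)
    (hFa : F ⊆ tightSet P a b) : F = tightSet P a b := by
  obtain ⟨c, -, hFc⟩ := hF.exists_functional
  obtain ⟨x₀, hx₀⟩ := hF.2.1
  have hmax : ∀ x ∈ F, ∀ y ∈ P, c ⬝ᵥ y ≤ c ⬝ᵥ x := fun x hx => (hFc ▸ hx :).2
  have haF : a ∈ constFunctionals F := mem_constFunctionals_of_subset_tightSet hFa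
  have hcF : c ∈ constFunctionals F := fun x hx y hy =>
    (hmax y hy x (hFa hx).1).antisymm (hmax x hx y (hFa hy).1)
  obtain ⟨r, rfl⟩ := Submodule.mem_span_singleton.1 (hF.constFunctionals_eq_span hP ha haF ▸ hcF)
  refine hFa.antisymm fun x hx => hFc ▸ ⟨hx.1, fun y hy => (hmax x₀ hx₀ y hy).trans_eq ?_⟩
  rw [smul_dotProduct, smul_dotProduct, hx.2, (hFa hx₀).2]

theorem IsFacet.exists_pos_smul_eq {a' : Fin n → ℝ} {b' : ℝ} (hP : affineDim P = n)
    (hF : IsFacet P (tightSet P a b)) (hab : ∀ x ∈ P, a ⬝ᵥ x ≤ b)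
    (hab' : ∀ x ∈ P, a' ⬝ᵥ x ≤ b') (ha' : a' ≠ 0)
    (hsub : tightSet P a b ⊆ tightSet P a' b') : ∃ r : ℝ, 0 < r ∧ a = r • a' := by
  obtain ⟨x₀, hx₀⟩ := hF.2.1
  have haF : a ∈ constFunctionals (tightSet P a b) :=
    mem_constFunctionals_of_subset_tightSet subset_rfl
  have hspan : constFunctionals (tightSet P a b) = ℝ ∙ a' :=
    hF.constFunctionals_eq_span hP ha' (mem_constFunctionals_of_subset_tightSet hsub)
  obtain ⟨r, rfl⟩ := Submodule.mem_span_singleton.1 (hspan ▸ haF)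
  refine ⟨r, ?_, rfl⟩
  obtain ⟨y, hyP, hyF⟩ : ∃ y ∈ P, y ∉ tightSet P (r • a') b := by
    by_contra! h
    have hcodim := hF.2.2
    rw [(Set.Subset.antisymm (fun _ hx => hx.1) h : tightSet P (r • a') b = P)] at hcodim
    lia
  have hlt : (r • a') ⬝ᵥ y < (r • a') ⬝ᵥ x₀ :=
    hx₀.2 ▸ (hab y hyP).lt_of_ne fun h => hyF ⟨hyP, h⟩
  have hle : a' ⬝ᵥ y ≤ a' ⬝ᵥ x₀ := (hsub hx₀).2 ▸ hab' y hyP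
  rw [smul_dotProduct, smul_dotProduct, smul_eq_mul, smul_eq_mul] at hlt
  by_contra! hr
  exact absurd hlt (mul_le_mul_of_nonpos_left hle hr).not_gt

end Facets

/-! ### The cone of antitone vectors -/

section AntitoneCone

theorem exists_mem_properCone_inner_sub_eq_zero {E : Type*} [NormedAddCommGroup E]
    [InnerProductSpace ℝ E] [CompleteSpace E] (K : ProperCone ℝ E) (c : E) :
    ∃ d ∈ K, inner ℝ (c - d) d = 0 ∧ ∀ x ∈ K, inner ℝ (c - d) x ≤ 0 := by
  obtain ⟨d, hd, hmin⟩ := exists_norm_eq_iInf_of_complete_convex K.nonempty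
    K.isClosed.isComplete K.toPointedCone.convex c
  have hle : ∀ x ∈ K, inner ℝ (c - d) (x - d) ≤ 0 :=
    (norm_eq_iInf_iff_real_inner_le_zero K.toPointedCone.convex hd).1 hmin
  have hpolar : ∀ x ∈ K, inner ℝ (c - d) x ≤ 0 := fun x hx => by
    simpa only [add_sub_cancel_right] using hle (x + d) (K.add_mem hx hd)
  have hzero := hle 0 K.zero_mem
  rw [zero_sub, inner_neg_right, neg_nonpos] at hzero
  exact ⟨d, hd, (hpolar d hd).antisymm hzero, hpolar⟩

/-- The closed convex cone of antitone vectors in Euclidean space. -/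
def antitoneCone (ι : Type*) [Fintype ι] [Preorder ι] : ProperCone ℝ (EuclideanSpace ℝ ι) where
  carrier := {x | Antitone x.ofLp}
  add_mem' hx hy := hx.add hy
  zero_mem' := antitone_const
  smul_mem' r _ hx := hx.const_smul r.2
  isClosed' := by
    have h : {x : EuclideanSpace ℝ ι | Antitone x.ofLp} =
        ⋂ i, ⋂ j, ⋂ _ : i ≤ j, {x | x j ≤ x i} := by
      ext x
      simp only [Set.mem_iInter]
      rfl
    change IsClosed {x : EuclideanSpace ℝ ι | Antitone x.ofLp}
    rw [h]
    exact isClosed_iInter fun i => isClosed_iInter fun j => isClosed_iInter fun _ =>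
      isClosed_le (by fun_prop) (by fun_prop)

theorem exists_antitone_dotProduct_sub_eq_zero {ι : Type*} [Fintype ι] [Preorder ι] (c : ι → ℝ) :
    ∃ d : ι → ℝ, Antitone d ∧ (c - d) ⬝ᵥ d = 0 ∧ ∀ x, Antitone x → (c - d) ⬝ᵥ x ≤ 0 := by
  obtain ⟨d, hd, hzero, hpolar⟩ :=
    exists_mem_properCone_inner_sub_eq_zero (antitoneCone ι) (WithLp.toLp 2 c)
  have hinner (x : EuclideanSpace ℝ ι) :
      inner ℝ (WithLp.toLp 2 c - d) x = (c - d.ofLp) ⬝ᵥ x.ofLp := by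
    rw [EuclideanSpace.inner_eq_star_dotProduct, star_trivial, dotProduct_comm, WithLp.ofLp_sub]
  exact ⟨d.ofLp, hd, hinner d ▸ hzero, fun x hx => hinner (WithLp.toLp 2 x) ▸ hpolar _ hx⟩

/-- The indicator vector of the first `p` coordinates. The vectors `prefixVec n p` and
`-prefixVec n n` generate the cone of antitone vectors. -/
def prefixVec (n p : ℕ) : Fin n → ℝ :=
  fun i => if (i : ℕ) < p then 1 else 0

theorem antitone_prefixVec (n p : ℕ) : Antitone (prefixVec n p) := by
  intro i j (hij : (i : ℕ) ≤ j)
  unfold prefixVec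
  split_ifs <;> first | lia | norm_num

theorem prefixVec_self (n : ℕ) : prefixVec n n = 1 :=
  funext fun i => if_pos i.2

theorem prefixVec_succ_sub_prefixVec {n : ℕ} (i : Fin n) :
    prefixVec n (i + 1) - prefixVec n i = Pi.single i 1 := by
  ext j
  simp only [prefixVec, Pi.sub_apply, Pi.single_apply, Fin.ext_iff]
  split_ifs <;> first | lia | norm_num

theorem eq_dotProduct_prefixVec_succ_sub {n : ℕ} (w : Fin n → ℝ) (i : Fin n) :
    w i = w ⬝ᵥ prefixVec n (i + 1) - w ⬝ᵥ prefixVec n i := by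
  rw [← dotProduct_sub, prefixVec_succ_sub_prefixVec, dotProduct_single_one]

theorem prefixVec_dotProduct_prefixVec {n p q : ℕ} (hpq : p ≤ q) (hp : p ≤ n) :
    prefixVec n p ⬝ᵥ prefixVec n q = p := by
  have hcard : (Finset.univ.filter fun i : Fin n => (i : ℕ) < p).card = p := by
    simp [Fin.card_filter_val_lt, hp]
  have hmul (i : Fin n) : prefixVec n p i * prefixVec n q i = if (i : ℕ) < p then 1 else 0 := by
    unfold prefixVec
    split_ifs <;> lia
  simp only [dotProduct, hmul, Finset.sum_boole, hcard]

theorem eq_sum_smul_prefixVec {m : ℕ} (x : Fin (m + 1) → ℝ) :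
    x = x (Fin.last m) • prefixVec (m + 1) (m + 1) +
      ∑ p : Fin m, (x p.castSucc - x p.succ) • prefixVec (m + 1) (p + 1) := by
  ext i
  simp only [Pi.add_apply, Pi.smul_apply, Finset.sum_apply, prefixVec_self, Pi.one_apply,
    smul_eq_mul, mul_one]
  induction i using Fin.reverseInduction with
  | last =>
    rw [Finset.sum_eq_zero, add_zero]
    intro p _
    rw [prefixVec, if_neg (by simp), mul_zero]
  | cast i ih =>
    have hstep (p : Fin m) : prefixVec (m + 1) (p + 1) i.castSucc =
        prefixVec (m + 1) (p + 1) i.succ + if p = i then 1 else 0 := by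
      simp only [prefixVec, Fin.val_castSucc, Fin.val_succ, Fin.ext_iff]
      split_ifs <;> first | lia | norm_num
    simp only [hstep, mul_add, Finset.sum_add_distrib, mul_ite, mul_one, mul_zero,
      Finset.sum_ite_eq', Finset.mem_univ, if_true]
    linarith

theorem dotProduct_one_eq_zero_of_polar {ι : Type*} [Fintype ι] [Preorder ι] {e : ι → ℝ}
    (he : ∀ x, Antitone x → e ⬝ᵥ x ≤ 0) : e ⬝ᵥ 1 = 0 := by
  refine (he 1 antitone_const).antisymm ?_
  have h := he (-1) fun _ _ _ => le_rfl
  rwa [dotProduct_neg, neg_nonpos] at h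

section Polar

variable {m : ℕ} {e : Fin (m + 1) → ℝ} (he : ∀ x, Antitone x → e ⬝ᵥ x ≤ 0)
include he

theorem dotProduct_eq_zero_iff_of_polar {x : Fin (m + 1) → ℝ} (hx : Antitone x) :
    e ⬝ᵥ x = 0 ↔
      ∀ p : Fin m, e ⬝ᵥ prefixVec (m + 1) (p + 1) = 0 ∨ x p.castSucc = x p.succ := by
  have hsum : e ⬝ᵥ x =
      ∑ p : Fin m, (x p.castSucc - x p.succ) * e ⬝ᵥ prefixVec (m + 1) (p + 1) := by
    conv_lhs => rw [eq_sum_smul_prefixVec x]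
    rw [dotProduct_add, dotProduct_smul, prefixVec_self, dotProduct_one_eq_zero_of_polar he,
      smul_zero, zero_add, dotProduct_sum]
    simp only [dotProduct_smul, smul_eq_mul]
  have hnonpos (p : Fin m) (_ : p ∈ Finset.univ) :
      (x p.castSucc - x p.succ) * e ⬝ᵥ prefixVec (m + 1) (p + 1) ≤ 0 :=
    mul_nonpos_of_nonneg_of_nonpos (sub_nonneg.2 (hx (Fin.castSucc_le_succ p)))
      (he _ (antitone_prefixVec _ _))
  rw [hsum, Finset.sum_eq_zero_iff_of_nonpos hnonpos]
  simp only [Finset.mem_univ, true_imp_iff, mul_eq_zero, sub_eq_zero, or_comm]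

theorem exists_dotProduct_prefixVec_ne_zero_of_polar (he0 : e ≠ 0) :
    ∃ p : Fin m, e ⬝ᵥ prefixVec (m + 1) (p + 1) ≠ 0 := by
  by_contra! h
  have hzero : ∀ x, Antitone x → e ⬝ᵥ x = 0 := fun x hx =>
    (dotProduct_eq_zero_iff_of_polar he hx).2 fun p => Or.inl (h p)
  refine he0 (funext fun i => ?_)
  rw [eq_dotProduct_prefixVec_succ_sub e i, hzero _ (antitone_prefixVec _ _),
    hzero _ (antitone_prefixVec _ _), sub_zero, Pi.zero_apply]

end Polar

end AntitoneCone

/-! ### Degree vectors -/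

section DegreeVectors

open scoped Classical in
/-- The degree sequence of a graph, as a real vector. -/
noncomputable def degVec {V : Type*} [Fintype V] (G : SimpleGraph V) : V → ℝ :=
  fun v => G.degree v

/-- The support function of the set of degree sequences of graphs on `V`, evaluated at `c`. An edge
`uv` contributes `c u + c v` to `c ⬝ᵥ degVec G`, so a graph maximizes `c` if it has all edges with
positive contribution and none with negative contribution. -/
noncomputable def degreeSupport {V : Type*} [Fintype V] [DecidableEq V] (c : V → ℝ) : ℝ :=
  (∑ u, ∑ v, if u = v then 0 else max 0 (c u + c v)) / 2

/-- The graph of the pairs with positive total weight. -/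
def thresholdGraph {V : Type*} (c : V → ℝ) : SimpleGraph V :=
  SimpleGraph.fromRel fun u v => 0 < c u + c v

/-- A shifted (or compressed) graph: moving one end of an edge to a smaller vertex gives an edge
again. Such graphs have antitone degree vectors. -/
def IsShifted {V : Type*} [Preorder V] (G : SimpleGraph V) : Prop :=
  ∀ ⦃u v w⦄, u < v → w ≠ u → G.Adj v w → G.Adj u w

variable {V : Type*} {c : V → ℝ}

theorem thresholdGraph_adj {u v : V} : (thresholdGraph c).Adj u v ↔ u ≠ v ∧ 0 < c u + c v := by
  rw [thresholdGraph, SimpleGraph.fromRel_adj, add_comm (c v), or_self]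

theorem isShifted_thresholdGraph [Preorder V] (hc : Antitone c) : IsShifted (thresholdGraph c) := by
  intro u v w huv hwu hvw
  rw [thresholdGraph_adj] at hvw ⊢
  exact ⟨hwu.symm, hvw.2.trans_le (add_le_add_left (hc huv.le) _)⟩

variable [Fintype V]

theorem degVec_apply (G : SimpleGraph V) [DecidableRel G.Adj] (u : V) :
    degVec G u = ∑ v, if G.Adj u v then 1 else 0 := by
  rw [Finset.sum_boole, degVec, ← SimpleGraph.card_neighborFinset_eq_degree,
    SimpleGraph.neighborFinset_eq_filter]
  congr!

theorem degVec_le_degVec {G : SimpleGraph V} {u v : V}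
    (h : ∀ w, w ≠ u → G.Adj v w → G.Adj u w) : degVec G v ≤ degVec G u := by
  classical
  rw [degVec_apply, degVec_apply, ← Equiv.sum_comp (Equiv.swap u v)]
  refine Finset.sum_le_sum fun w _ => ?_
  rcases eq_or_ne w u with rfl | hu
  · simp
  rcases eq_or_ne w v with rfl | hv
  · simp [G.adj_comm]
  rw [Equiv.swap_apply_of_ne_of_ne hu hv]
  split_ifs with hvw huw
  · rfl
  · exact absurd (h w hu hvw) huw
  · exact zero_le_one
  · rfl

theorem IsShifted.antitone_degVec [PartialOrder V] {G : SimpleGraph V} (hG : IsShifted G) :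
    Antitone (degVec G) := by
  intro u v huv
  rcases huv.eq_or_lt with rfl | hlt
  · rfl
  · exact degVec_le_degVec fun w => hG hlt

theorem degVec_thresholdGraph_le {u v : V} (h : c v ≤ c u) :
    degVec (thresholdGraph c) v ≤ degVec (thresholdGraph c) u := by
  refine degVec_le_degVec fun w hwu hvw => ?_
  rw [thresholdGraph_adj] at hvw ⊢
  exact ⟨hwu.symm, hvw.2.trans_le (add_le_add_left h _)⟩

theorem two_mul_dotProduct_degVec (c : V → ℝ) (G : SimpleGraph V) [DecidableRel G.Adj] :
    2 * c ⬝ᵥ degVec G = ∑ u, ∑ v, if G.Adj u v then c u + c v else 0 := by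
  have hleft : c ⬝ᵥ degVec G = ∑ u, ∑ v, if G.Adj u v then c u else 0 := by
    simp only [dotProduct, degVec_apply, Finset.mul_sum, mul_ite, mul_one, mul_zero]
  have hright : c ⬝ᵥ degVec G = ∑ u, ∑ v, if G.Adj u v then c v else 0 := by
    rw [hleft, Finset.sum_comm]
    simp only [G.adj_comm]
  rw [two_mul]
  nth_rewrite 1 [hleft]
  rw [hright, ← Finset.sum_add_distrib]
  simp only [← Finset.sum_add_distrib, ← ite_add_zero]

theorem degVec_eq_degVec_sdiff_edge_add [DecidableEq V] {G : SimpleGraph V} {u v : V}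
    (huv : G.Adj u v) :
    degVec G = degVec (G \ SimpleGraph.edge u v) + Pi.single u 1 + Pi.single v 1 := by
  classical
  ext w
  have hadj (x : V) : (if G.Adj w x then (1 : ℝ) else 0) =
      (if (G \ SimpleGraph.edge u v).Adj w x then 1 else 0) +
        (if x = v then if w = u then 1 else 0 else 0) +
        if x = u then if w = v then 1 else 0 else 0 := by
    have hne := huv.ne
    have hvu := huv.symm
    simp only [SimpleGraph.sdiff_adj, SimpleGraph.edge_adj]
    grind
  simp only [Pi.add_apply, degVec_apply, hadj, Finset.sum_add_distrib, Finset.sum_ite_eq',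
    Finset.mem_univ, if_true, Pi.single_apply]

theorem add_eq_zero_of_degVec_mem {G : SimpleGraph V} {u v : V} (huv : G.Adj u v)
    {F : Set (V → ℝ)} (hG : degVec G ∈ F) (hG' : degVec (G \ SimpleGraph.edge u v) ∈ F)
    {w : V → ℝ} (hw : w ∈ constFunctionals F) : w u + w v = 0 := by
  classical
  have hconst := hw _ hG _ hG'
  rw [degVec_eq_degVec_sdiff_edge_add huv, dotProduct_add, dotProduct_add, dotProduct_single_one,
    dotProduct_single_one] at hconst
  linarith

variable [DecidableEq V]

theorem dotProduct_degVec_le_degreeSupport (c : V → ℝ) (G : SimpleGraph V) :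
    c ⬝ᵥ degVec G ≤ degreeSupport c := by
  classical
  rw [degreeSupport, le_div_iff₀' two_pos, two_mul_dotProduct_degVec]
  refine Finset.sum_le_sum fun u _ => Finset.sum_le_sum fun v _ => ?_
  split_ifs with hadj heq
  · exact absurd heq hadj.ne
  · exact le_max_right _ _
  · rfl
  · exact le_max_left _ _

theorem dotProduct_degVec_eq_degreeSupport {G : SimpleGraph V}
    (hpos : thresholdGraph c ≤ G) (hnonneg : ∀ u v, G.Adj u v → 0 ≤ c u + c v) :
    c ⬝ᵥ degVec G = degreeSupport c := by
  classical
  rw [degreeSupport, eq_div_iff two_ne_zero, mul_comm, two_mul_dotProduct_degVec]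
  refine Finset.sum_congr rfl fun u _ => Finset.sum_congr rfl fun v _ => ?_
  split_ifs with hadj heq heq
  · exact absurd heq hadj.ne
  · exact (max_eq_right (hnonneg u v hadj)).symm
  · rfl
  · exact (max_eq_left (not_lt.1 fun h => hadj (hpos (thresholdGraph_adj.2 ⟨heq, h⟩)))).symm

theorem dotProduct_degVec_thresholdGraph (c : V → ℝ) :
    c ⬝ᵥ degVec (thresholdGraph c) = degreeSupport c :=
  dotProduct_degVec_eq_degreeSupport le_rfl fun _ _ h => (thresholdGraph_adj.1 h).2.le

theorem degreeSupport_comp_perm (c : V → ℝ) (σ : Equiv.Perm V) :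
    degreeSupport (c ∘ σ) = degreeSupport c := by
  refine congrArg (· / 2) (Fintype.sum_equiv σ _ _ fun u => Fintype.sum_equiv σ _ _ fun v => ?_)
  simp only [Function.comp_apply, σ.injective.eq_iff]

theorem degreeSupport_add {a b : V → ℝ} (h : ∀ u v, u ≠ v → 0 ≤ (a u + a v) * (b u + b v)) :
    degreeSupport (a + b) = degreeSupport a + degreeSupport b := by
  simp only [degreeSupport, ← add_div, ← Finset.sum_add_distrib]
  congr! 3 with u _ v _
  split_ifs with huv
  · rw [add_zero]
  rw [Pi.add_apply, Pi.add_apply, add_add_add_comm]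
  rcases mul_nonneg_iff.1 (h u v huv) with ⟨ha, hb⟩ | ⟨ha, hb⟩
  · rw [max_eq_right ha, max_eq_right hb, max_eq_right (add_nonneg ha hb)]
  · rw [max_eq_left ha, max_eq_left hb, max_eq_left (add_nonpos ha hb), add_zero]

theorem degreeSupport_smul {t : ℝ} (ht : 0 ≤ t) (c : V → ℝ) :
    degreeSupport (t • c) = t * degreeSupport c := by
  simp only [degreeSupport, Pi.smul_apply, smul_eq_mul, mul_div_assoc', Finset.mul_sum, mul_ite,
    mul_zero, ← mul_add, mul_max_of_nonneg _ _ ht]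

/-- A small positive multiple of `a` can be subtracted from `c` without changing the sign of any
edge weight `c u + c v`, and `degreeSupport` is additive where all edge weights agree in sign. -/
theorem exists_pos_degreeSupport_eq_add {a c : V → ℝ}
    (h : ∀ u v, u ≠ v → a u + a v ≠ 0 → 0 < (a u + a v) * (c u + c v)) :
    ∃ t : ℝ, 0 < t ∧ degreeSupport c = t * degreeSupport a + degreeSupport (c - t • a) := by
  have hsmall : ∀ᶠ t : ℝ in nhdsWithin 0 (Set.Ioi 0), ∀ u v, u ≠ v →
      0 ≤ (a u + a v) * (c u + c v - t * (a u + a v)) := by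
    refine Filter.eventually_all.2 fun u => Filter.eventually_all.2 fun v =>
      Filter.eventually_imp_distrib_left.2 fun huv => ?_
    rcases eq_or_ne (a u + a v) 0 with h0 | h0
    · exact Filter.Eventually.of_forall fun t => by rw [h0, zero_mul]
    · have hcont : Continuous fun t : ℝ => (a u + a v) * (c u + c v - t * (a u + a v)) := by
        fun_prop
      have hpos : 0 < (a u + a v) * (c u + c v - 0 * (a u + a v)) := by
        simpa only [zero_mul, sub_zero] using h u v huv h0
      exact (hcont.continuousAt.eventually_const_le hpos).filter_mono nhdsWithin_le_nhds
  obtain ⟨t, hac, ht : 0 < t⟩ := (hsmall.and self_mem_nhdsWithin).exists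
  refine ⟨t, ht, ?_⟩
  rw [← degreeSupport_smul ht.le, ← degreeSupport_add, add_sub_cancel]
  intro u v huv
  simp only [Pi.smul_apply, Pi.sub_apply, smul_eq_mul]
  linarith [mul_nonneg ht.le (hac u v huv)]

end DegreeVectors

section SplitGraphs

variable {n : ℕ}

/-- The graph in which the first `p` vertices form a clique and are joined to all of the first `q`
vertices, without further edges. Cliques (`p = q`) and stars (`p = 1`) are special cases. -/
def splitGraph (n p q : ℕ) : SimpleGraph (Fin n) :=
  SimpleGraph.fromRel fun u v => (u : ℕ) < p ∧ (v : ℕ) < q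

theorem splitGraph_adj {p q : ℕ} {u v : Fin n} : (splitGraph n p q).Adj u v ↔
    u ≠ v ∧ ((u : ℕ) < p ∧ (v : ℕ) < q ∨ (v : ℕ) < p ∧ (u : ℕ) < q) := by
  rw [splitGraph, SimpleGraph.fromRel_adj]

theorem isShifted_splitGraph (n p q : ℕ) : IsShifted (splitGraph n p q) := by
  intro u v w (huv : (u : ℕ) < v) hwu hvw
  rw [splitGraph_adj] at hvw ⊢
  exact ⟨hwu.symm, by lia⟩

theorem degVec_splitGraph {p q : ℕ} (hpq : p ≤ q) (hq : q ≤ n) :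
    degVec (splitGraph n p q) =
      ((q : ℝ) - p - 1) • prefixVec n p + (p : ℝ) • prefixVec n q := by
  classical
  ext u
  have hadj (v : Fin n) : (if (splitGraph n p q).Adj u v then (1 : ℝ) else 0) =
      prefixVec n p u * prefixVec n q v + (prefixVec n q u - prefixVec n p u) * prefixVec n p v -
        if v = u then prefixVec n p u else 0 := by
    simp only [splitGraph_adj, prefixVec, Fin.ext_iff]
    grind
  have hsum {r : ℕ} (hr : r ≤ n) : ∑ v, prefixVec n r v = r := by
    rw [← prefixVec_dotProduct_prefixVec hr hr, prefixVec_self, dotProduct_one]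
  simp only [degVec_apply, hadj, Finset.sum_sub_distrib, Finset.sum_add_distrib, ← Finset.mul_sum,
    hsum hq, hsum (hpq.trans hq), Finset.sum_ite_eq', Finset.mem_univ, if_true, Pi.add_apply,
    Pi.smul_apply, smul_eq_mul]
  ring

end SplitGraphs

/-! ### The polytope of degree partitions -/

section Polytope

variable {n : ℕ} {c : Fin n → ℝ}

theorem IsShifted.degVec_mem {G : SimpleGraph (Fin n)} (hG : IsShifted G) :
    degVec G ∈ degreePartitionPolytope n := by
  classical
  have hanti : Antitone fun i => G.degree i :=
    fun i j hij => (Nat.cast_le (α := ℝ)).1 (hG.antitone_degVec hij)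
  exact subset_convexHull ℝ _ ⟨_, ⟨hanti, G, 1, fun _ => rfl⟩, rfl⟩

theorem antitone_of_mem_degreePartitionPolytope {x : Fin n → ℝ}
    (hx : x ∈ degreePartitionPolytope n) : Antitone x := by
  have hconv : Convex ℝ {x : Fin n → ℝ | Antitone x} := fun x hx y hy s t hs ht _ =>
    (hx.const_smul hs).add (hy.const_smul ht)
  refine convexHull_min ?_ hconv hx
  rintro _ ⟨d, ⟨hd, -⟩, rfl⟩
  exact fun i j hij => Nat.cast_le.2 (hd hij)

theorem dotProduct_le_degreeSupport_of_mem (c : Fin n → ℝ) {x : Fin n → ℝ}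
    (hx : x ∈ degreePartitionPolytope n) : c ⬝ᵥ x ≤ degreeSupport c := by
  have hconv : Convex ℝ {x : Fin n → ℝ | c ⬝ᵥ x ≤ degreeSupport c} :=
    convex_halfSpace_le ⟨dotProduct_add c, fun r => dotProduct_smul r c⟩ _
  refine convexHull_min ?_ hconv hx
  rintro _ ⟨d, ⟨-, G, σ, hd⟩, rfl⟩
  have hperm : c ⬝ᵥ (fun i => (d i : ℝ)) = (c ∘ σ.symm) ⬝ᵥ degVec G := by
    refine Fintype.sum_equiv σ _ _ fun i => ?_
    simp only [Function.comp_apply, Equiv.symm_apply_apply, degVec, hd]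
  rw [Set.mem_ofPred_eq, hperm, ← degreeSupport_comp_perm c σ.symm]
  exact dotProduct_degVec_le_degreeSupport _ G

/-- The face of the polytope of degree partitions on which the functional `c ⬝ᵥ ·` takes the value
`degreeSupport c`. It is nonempty, hence the set of maximizers of `c`, if `c` is antitone. -/
def supportFace (c : Fin n → ℝ) : Set (Fin n → ℝ) :=
  tightSet (degreePartitionPolytope n) c (degreeSupport c)

theorem IsShifted.degVec_mem_supportFace {G : SimpleGraph (Fin n)} (hG : IsShifted G)
    (hpos : thresholdGraph c ≤ G) (hnonneg : ∀ u v, G.Adj u v → 0 ≤ c u + c v) :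
    degVec G ∈ supportFace c :=
  ⟨hG.degVec_mem, dotProduct_degVec_eq_degreeSupport hpos hnonneg⟩

theorem degVec_thresholdGraph_mem_supportFace (hc : Antitone c) :
    degVec (thresholdGraph c) ∈ supportFace c :=
  ⟨(isShifted_thresholdGraph hc).degVec_mem, dotProduct_degVec_thresholdGraph c⟩

theorem mem_supportFace_of_forall_le (hc : Antitone c) {x : Fin n → ℝ}
    (hx : x ∈ degreePartitionPolytope n)
    (hmax : ∀ y ∈ degreePartitionPolytope n, c ⬝ᵥ y ≤ c ⬝ᵥ x) : x ∈ supportFace c :=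
  have ht := degVec_thresholdGraph_mem_supportFace hc
  ⟨hx, (dotProduct_le_degreeSupport_of_mem c hx).antisymm (ht.2 ▸ hmax _ ht.1)⟩

theorem supportFace_subset_supportFace {a : Fin n → ℝ}
    (h : ∀ u v, u ≠ v → a u + a v ≠ 0 → 0 < (a u + a v) * (c u + c v)) :
    supportFace c ⊆ supportFace a := by
  rintro x ⟨hx, hcx⟩
  obtain ⟨t, ht, hsplit⟩ := exists_pos_degreeSupport_eq_add h
  have hax := dotProduct_le_degreeSupport_of_mem a hx
  have hdx := dotProduct_le_degreeSupport_of_mem (c - t • a) hx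
  rw [sub_dotProduct, smul_dotProduct, smul_eq_mul] at hdx
  exact ⟨hx, hax.antisymm (le_of_mul_le_mul_left (by linarith) ht)⟩

/-- The Moreau decomposition `c = d + e` of `c` along the cone of antitone vectors reduces the
maximization of `c` to that of `d`: the threshold graph of `d` maximizes `d`, and it also satisfies
`e ⬝ᵥ x = 0` because its degrees respect the ties of `d`. -/
theorem exists_tie_of_not_antitone (hc : ¬ Antitone c) :
    ∃ i j : Fin n, (j : ℕ) = i + 1 ∧ ∀ x ∈ degreePartitionPolytope n,
      (∀ y ∈ degreePartitionPolytope n, c ⬝ᵥ y ≤ c ⬝ᵥ x) → x i = x j := by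
  obtain _ | m := n
  · exact absurd (Subsingleton.antitone c) hc
  obtain ⟨d, hd, hed, hpolar⟩ := exists_antitone_dotProduct_sub_eq_zero c
  have he0 : c - d ≠ 0 := fun h => hc (sub_eq_zero.1 h ▸ hd)
  obtain ⟨p, hp⟩ := exists_dotProduct_prefixVec_ne_zero_of_polar hpolar he0
  refine ⟨p.castSucc, p.succ, by simp, fun x hx hmax => ?_⟩
  set t := degVec (thresholdGraph d)
  have ht : t ∈ supportFace d := degVec_thresholdGraph_mem_supportFace hd
  have hties : ∀ i j, d i = d j → t i = t j := fun i j hij =>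
    (degVec_thresholdGraph_le hij.le).antisymm (degVec_thresholdGraph_le hij.ge)
  have het : (c - d) ⬝ᵥ t = 0 :=
    (dotProduct_eq_zero_iff_of_polar hpolar (antitone_of_mem_degreePartitionPolytope ht.1)).2
      fun q => ((dotProduct_eq_zero_iff_of_polar hpolar hd).1 hed q).imp_right (hties _ _)
  have hex : (c - d) ⬝ᵥ x = 0 := by
    have hxanti := antitone_of_mem_degreePartitionPolytope hx
    have hct := hmax t ht.1
    have hdx := dotProduct_le_degreeSupport_of_mem d hx
    have hdt := ht.2
    refine (hpolar x hxanti).antisymm ?_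
    rw [sub_dotProduct] at het ⊢
    linarith
  exact ((dotProduct_eq_zero_iff_of_polar hpolar
    (antitone_of_mem_degreePartitionPolytope hx)).1 hex p).resolve_left hp

theorem isShifted_sdiff_edge {G : SimpleGraph (Fin n)} (hG : IsShifted G) {i j : Fin n}
    (hi : ∀ u, i < u → ¬ G.Adj u j) (hj : ∀ u, j < u → ¬ G.Adj u i) :
    IsShifted (G \ SimpleGraph.edge i j) := by
  intro u v w huv hwu hvw
  rw [SimpleGraph.sdiff_adj, SimpleGraph.edge_adj] at hvw ⊢
  refine ⟨hG huv hwu hvw.1, ?_⟩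
  rintro ⟨⟨rfl, rfl⟩ | ⟨rfl, rfl⟩, -⟩
  · exact hi v huv hvw.1
  · exact hj v huv hvw.1

/-- The edge `ij` contributes nothing to `c`, so it can be switched on and off within the face, as
the last edge of the shifted closure of the threshold graph and `ij`. -/
theorem add_eq_zero_of_mem_constFunctionals_supportFace (hc : Antitone c) {i j : Fin n}
    (hij : i < j) (hcij : c i + c j = 0) {w : Fin n → ℝ}
    (hw : w ∈ constFunctionals (supportFace c)) : w i + w j = 0 := by
  set G : SimpleGraph (Fin n) := thresholdGraph c ⊔ splitGraph n (i + 1) (j + 1)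
  have hG : IsShifted G := fun u v w huv hwu hvw =>
    hvw.imp (isShifted_thresholdGraph hc huv hwu) (isShifted_splitGraph _ _ _ huv hwu)
  have hadj : G.Adj i j := Or.inr (splitGraph_adj.2 ⟨hij.ne, by lia⟩)
  have hnonneg : ∀ u v, G.Adj u v → 0 ≤ c u + c v := by
    have hsplit {u v : Fin n} (hu : (u : ℕ) < i + 1) (hv : (v : ℕ) < j + 1) : 0 ≤ c u + c v :=
      hcij ▸ add_le_add (hc (Fin.le_def.2 (by lia))) (hc (Fin.le_def.2 (by lia)))
    rintro u v (h | h)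
    · exact (thresholdGraph_adj.1 h).2.le
    · rcases (splitGraph_adj.1 h).2 with h | h
      · exact hsplit h.1 h.2
      · exact add_comm (c u) _ ▸ hsplit h.1 h.2
  have hG' : IsShifted (G \ SimpleGraph.edge i j) := by
    refine isShifted_sdiff_edge hG ?_ ?_ <;> rintro u hu (h | h)
    · linarith [hc hu.le, (thresholdGraph_adj.1 h).2]
    · have := (splitGraph_adj.1 h).2
      lia
    · linarith [hc hu.le, (thresholdGraph_adj.1 h).2]
    · have := (splitGraph_adj.1 h).2
      lia
  have hpos : thresholdGraph c ≤ G \ SimpleGraph.edge i j := by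
    refine fun u v huv => ⟨Or.inl huv, fun h => ?_⟩
    have := (thresholdGraph_adj.1 huv).2
    obtain ⟨⟨rfl, rfl⟩ | ⟨rfl, rfl⟩, -⟩ := (SimpleGraph.edge_adj ..).1 h <;> linarith
  exact add_eq_zero_of_degVec_mem hadj (hG.degVec_mem_supportFace le_sup_left hnonneg)
    (hG'.degVec_mem_supportFace hpos fun u v h => hnonneg u v h.1) hw

end Polytope

/-! ### The faces `x i = x j` -/

section TieFaces

variable {n : ℕ} {i j : Fin n}

/-- The coefficient vector of the inequality `x j - x i ≤ 0`. -/
def tieVec (i j : Fin n) : Fin n → ℝ :=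
  Pi.single j 1 - Pi.single i 1

/-- The face of the polytope of degree partitions on which the coordinates `i` and `j` agree. -/
def tieFace (i j : Fin n) : Set (Fin n → ℝ) :=
  tightSet (degreePartitionPolytope n) (tieVec i j) 0

theorem tieVec_dotProduct (i j : Fin n) (x : Fin n → ℝ) : tieVec i j ⬝ᵥ x = x j - x i := by
  rw [tieVec, sub_dotProduct, single_one_dotProduct, single_one_dotProduct]

theorem mem_tieFace {x : Fin n → ℝ} :
    x ∈ tieFace i j ↔ x ∈ degreePartitionPolytope n ∧ x i = x j := by
  rw [eq_comm (a := x i), ← sub_eq_zero, ← tieVec_dotProduct]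
  exact Iff.rfl

theorem tieFace_eq_setOf (i j : Fin n) :
    tieFace i j = {x ∈ degreePartitionPolytope n | x i = x j} :=
  Set.ext fun _ => mem_tieFace

theorem tieVec_ne_zero (hij : i ≠ j) : tieVec i j ≠ 0 := by
  intro h
  have hj := congrFun h j
  rw [tieVec, Pi.sub_apply, Pi.single_eq_same, Pi.single_eq_of_ne hij.symm] at hj
  norm_num at hj

theorem tieVec_dotProduct_nonpos (hij : i ≤ j) :
    ∀ x ∈ degreePartitionPolytope n, tieVec i j ⬝ᵥ x ≤ 0 := fun x hx => by
  rw [tieVec_dotProduct, sub_nonpos]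
  exact antitone_of_mem_degreePartitionPolytope hx hij

theorem degVec_splitGraph_mem_tieFace (hij : (j : ℕ) = i + 1) {p q : ℕ} (hpq : p ≤ q) (hq : q ≤ n)
    (hpj : p ≠ j) (hqj : q ≠ j) : degVec (splitGraph n p q) ∈ tieFace i j := by
  have htie {r : ℕ} (hr : r ≠ j) : prefixVec n r i = prefixVec n r j :=
    if_congr (by lia) rfl rfl
  refine mem_tieFace.2 ⟨(isShifted_splitGraph n p q).degVec_mem, ?_⟩
  simp only [degVec_splitGraph hpq hq, Pi.add_apply, Pi.smul_apply, htie hpj, htie hqj]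

theorem dotProduct_prefixVec_eq_zero_of_mem_constFunctionals_tieFace (hn : 3 ≤ n)
    (hij : (j : ℕ) = i + 1) {w : Fin n → ℝ} (hw : w ∈ constFunctionals (tieFace i j)) {p : ℕ}
    (hp : p ≤ n) (hpj : p ≠ j) : w ⬝ᵥ prefixVec n p = 0 := by
  have hzero : w ⬝ᵥ prefixVec n 0 = 0 := by
    rw [show prefixVec n 0 = 0 from funext fun _ => if_neg (Nat.not_lt_zero _), dotProduct_zero]
  have hsplit {p q : ℕ} (hpq : p ≤ q) (hq : q ≤ n) (hpj : p ≠ j) (hqj : q ≠ j) :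
      ((q : ℝ) - p - 1) * w ⬝ᵥ prefixVec n p + p * w ⬝ᵥ prefixVec n q = 0 := by
    have h := hw _ (degVec_splitGraph_mem_tieFace hij hpq hq hpj hqj) _
      (degVec_splitGraph_mem_tieFace hij le_rfl n.zero_le (by lia) (by lia))
    simpa only [degVec_splitGraph hpq hq, degVec_splitGraph le_rfl n.zero_le, dotProduct_add,
      dotProduct_smul, hzero, smul_eq_mul, mul_zero, add_zero] using h
  have hclique {p : ℕ} (hp2 : 2 ≤ p) (hp : p ≤ n) (hpj : p ≠ j) : w ⬝ᵥ prefixVec n p = 0 := by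
    have hp1 : (p : ℝ) - 1 ≠ 0 := sub_ne_zero.2 (by norm_cast; lia)
    refine (mul_eq_zero.1 ?_).resolve_left hp1
    linear_combination hsplit le_rfl hp hpj hpj
  obtain rfl | rfl | hp2 : p = 0 ∨ p = 1 ∨ 2 ≤ p := by lia
  · exact hzero
  · have hn2 : (n : ℝ) - 2 ≠ 0 := sub_ne_zero.2 (by norm_cast; lia)
    have hstar := hsplit hp le_rfl hpj (by lia)
    rw [hclique (by lia) le_rfl (by lia)] at hstar
    refine (mul_eq_zero.1 ?_).resolve_left hn2
    linear_combination hstar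
  · exact hclique hp2 hp hpj

theorem constFunctionals_tieFace_le (hn : 3 ≤ n) (hij : (j : ℕ) = i + 1) :
    constFunctionals (tieFace i j) ≤ ℝ ∙ tieVec i j := by
  intro w hw
  have hzero {p : ℕ} (hp : p ≤ n) (hpj : p ≠ j) :=
    dotProduct_prefixVec_eq_zero_of_mem_constFunctionals_tieFace hn hij hw hp hpj
  refine Submodule.mem_span_singleton.2 ⟨-(w ⬝ᵥ prefixVec n j), funext fun u => ?_⟩
  rw [eq_dotProduct_prefixVec_succ_sub w u, Pi.smul_apply, tieVec, Pi.sub_apply, Pi.single_apply,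
    Pi.single_apply, smul_eq_mul]
  rcases eq_or_ne u j with rfl | huj
  · rw [if_pos rfl, if_neg (by lia), hzero u.2 (by lia)]
    ring
  rcases eq_or_ne u i with rfl | hui
  · rw [if_neg huj, if_pos rfl, ← hij, hzero u.2.le (by lia)]
    ring
  · rw [if_neg huj, if_neg hui, hzero u.2 (by lia), hzero u.2.le (by lia)]
    ring

theorem affineDim_degreePartitionPolytope (hn : 3 ≤ n) :
    affineDim (degreePartitionPolytope n) = n := by
  refine affineDim_eq_of_constFunctionals_eq_bot ((Submodule.eq_bot_iff _).2 fun w hw => ?_)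
  have hzero {p q : ℕ} (hp : p ≤ n) (hq : q + 1 < n) (hpq : p ≠ q + 1) : w ⬝ᵥ prefixVec n p = 0 :=
    dotProduct_prefixVec_eq_zero_of_mem_constFunctionals_tieFace hn (i := ⟨q, by lia⟩)
      (j := ⟨q + 1, hq⟩) rfl (fun x hx y hy => hw x hx.1 y hy.1) hp hpq
  have hall {p : ℕ} (hp : p ≤ n) : w ⬝ᵥ prefixVec n p = 0 := by
    rcases eq_or_ne p 1 with rfl | hp1
    · exact hzero (q := 1) hp (by lia) (by lia)
    · exact hzero (q := 0) hp (by lia) hp1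
  ext u
  rw [eq_dotProduct_prefixVec_succ_sub w u, hall u.2, hall u.2.le, sub_zero, Pi.zero_apply]

theorem isFacet_tieFace (hn : 3 ≤ n) (hij : (j : ℕ) = i + 1) :
    IsFacet (degreePartitionPolytope n) (tieFace i j) :=
  have hlt : i < j := by lia
  isFacet_tightSet (affineDim_degreePartitionPolytope hn) (tieVec_ne_zero hlt.ne)
    (tieVec_dotProduct_nonpos hlt.le)
    ⟨_, degVec_splitGraph_mem_tieFace hij le_rfl n.zero_le (by lia) (by lia)⟩
    (constFunctionals_tieFace_le hn hij)

end TieFaces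

/-! ### The faces of the Fulkerson–Hoffman–McAndrew inequalities -/

section FHM

variable {n k l : ℕ}

/-- The coefficient vector of the Fulkerson–Hoffman–McAndrew inequality: `1` on the first `k`
coordinates, `-1` on the last `l` and `0` in between. -/
def fhmVec (n k l : ℕ) : Fin n → ℝ :=
  prefixVec n k + prefixVec n (n - l) - 1

theorem antitone_fhmVec (n k l : ℕ) : Antitone (fhmVec n k l) := fun _ _ h =>
  sub_le_sub_right (add_le_add (antitone_prefixVec n k h) (antitone_prefixVec n (n - l) h)) _

theorem fhmVec_apply (h : k + l ≤ n) (i : Fin n) :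
    fhmVec n k l i = if (i : ℕ) < k then 1 else if (i : ℕ) < n - l then 0 else -1 := by
  simp only [fhmVec, prefixVec, Pi.sub_apply, Pi.add_apply, Pi.one_apply]
  split_ifs <;> first | lia | norm_num

theorem fhmVec_pos_iff (h : k + l ≤ n) {i : Fin n} : 0 < fhmVec n k l i ↔ (i : ℕ) < k := by
  rw [fhmVec_apply h]
  split_ifs with hk <;> simp [hk]

theorem fhmVec_neg_iff (h : k + l ≤ n) {i : Fin n} : fhmVec n k l i < 0 ↔ n - l ≤ (i : ℕ) := by
  rw [fhmVec_apply h]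
  split_ifs with hk hl <;> norm_num <;> lia

theorem fhmVec_ne_zero_iff (h : k + l ≤ n) : fhmVec n k l ≠ 0 ↔ 1 ≤ k + l := by
  constructor
  · contrapose!
    intro h0
    obtain ⟨rfl, rfl⟩ : k = 0 ∧ l = 0 := by lia
    ext i
    simp [fhmVec_apply h]
  · intro h0 hzero
    have hk := fhmVec_pos_iff h (i := ⟨0, by lia⟩)
    have hl := fhmVec_neg_iff h (i := ⟨n - 1, by lia⟩)
    simp only [hzero, Pi.zero_apply, lt_irrefl, false_iff] at hk hl
    lia

theorem fhmLhs_eq_dotProduct (n k l : ℕ) (x : Fin n → ℝ) :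
    fhmLhs n k l x = fhmVec n k l ⬝ᵥ x := by
  rw [fhmLhs, Finset.sum_filter, Finset.sum_filter, ← Finset.sum_sub_distrib]
  refine Finset.sum_congr rfl fun i _ => ?_
  simp only [fhmVec, prefixVec, Pi.sub_apply, Pi.add_apply, Pi.one_apply]
  split_ifs <;> first | lia | ring

theorem degVec_splitGraph_mem_supportFace_fhmVec (h : k + l ≤ n) :
    degVec (splitGraph n k (n - l)) ∈ supportFace (fhmVec n k l) := by
  refine (isShifted_splitGraph n k (n - l)).degVec_mem_supportFace ?_ ?_ <;> intro u v huv
  · rw [thresholdGraph_adj, fhmVec_apply h, fhmVec_apply h] at huv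
    refine splitGraph_adj.2 ⟨huv.1, ?_⟩
    have := huv.2
    split_ifs at this <;> first | lia | norm_num at this
  · have := (splitGraph_adj.1 huv).2
    rw [fhmVec_apply h, fhmVec_apply h]
    split_ifs <;> first | lia | norm_num

theorem degreeSupport_fhmVec (h : k + l ≤ n) : degreeSupport (fhmVec n k l) = fhmRhs n k l := by
  have hkl : k ≤ n - l := by lia
  have hl : n - l ≤ n := by lia
  rw [← (degVec_splitGraph_mem_supportFace_fhmVec h).2, degVec_splitGraph hkl hl, fhmVec,
    ← prefixVec_self, sub_dotProduct, add_dotProduct]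
  simp only [dotProduct_add, dotProduct_smul, smul_eq_mul]
  rw [dotProduct_comm (prefixVec n (n - l)) (prefixVec n k), dotProduct_comm (prefixVec n n),
    dotProduct_comm (prefixVec n n)]
  rw [prefixVec_dotProduct_prefixVec le_rfl (by lia), prefixVec_dotProduct_prefixVec hkl (by lia),
    prefixVec_dotProduct_prefixVec le_rfl hl, prefixVec_dotProduct_prefixVec (by lia) (by lia),
    prefixVec_dotProduct_prefixVec hl hl]
  rw [fhmRhs, Nat.cast_sub (by lia)]
  ring

/-- The face of the polytope of degree partitions on which the Fulkerson–Hoffman–McAndrew inequality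
holds with equality. -/
def fhmFace (n k l : ℕ) : Set (Fin n → ℝ) :=
  tightSet (degreePartitionPolytope n) (fhmVec n k l) (fhmRhs n k l)

theorem fhmFace_eq_setOf (n k l : ℕ) :
    fhmFace n k l = {x ∈ degreePartitionPolytope n | fhmLhs n k l x = fhmRhs n k l} := by
  simp only [fhmLhs_eq_dotProduct]
  rfl

theorem supportFace_fhmVec (h : k + l ≤ n) : supportFace (fhmVec n k l) = fhmFace n k l := by
  rw [supportFace, degreeSupport_fhmVec h, fhmFace]

theorem fhmVec_dotProduct_le (h : k + l ≤ n) :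
    ∀ x ∈ degreePartitionPolytope n, fhmVec n k l ⬝ᵥ x ≤ fhmRhs n k l := fun _ hx =>
  degreeSupport_fhmVec h ▸ dotProduct_le_degreeSupport_of_mem _ hx

theorem exists_forall_iff_val_lt {p : Fin n → Prop} (hp : Antitone p) :
    ∃ k ≤ n, ∀ i : Fin n, p i ↔ (i : ℕ) < k := by
  classical
  have hex : ∃ k, ∀ i : Fin n, k ≤ (i : ℕ) → ¬ p i := ⟨n, fun i hi => by lia⟩
  refine ⟨Nat.find hex, Nat.find_min' hex fun i hi => by lia, fun i => ⟨fun hi => ?_, fun hi => ?_⟩⟩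
  · exact not_le.1 fun h => Nat.find_spec hex i h hi
  · obtain ⟨j, hij, hj⟩ : ∃ j : Fin n, (i : ℕ) ≤ j ∧ p j := by simpa using Nat.find_min hex hi
    exact hp hij hj

theorem exists_fhmVec_eq_sign {c : Fin n → ℝ} (hc : Antitone c) :
    ∃ k l, k + l ≤ n ∧ ∀ i, fhmVec n k l i = SignType.sign (c i) := by
  obtain ⟨k, hk, hpos⟩ := exists_forall_iff_val_lt (p := fun i => 0 < c i)
    fun i j hij h => h.trans_le (hc hij)
  obtain ⟨q, hq, hnonneg⟩ := exists_forall_iff_val_lt (p := fun i => 0 ≤ c i)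
    fun i j hij h => h.trans (hc hij)
  have hkq : k ≤ q := by
    by_contra! h
    exact lt_irrefl q ((hnonneg ⟨q, by lia⟩).1 ((hpos ⟨q, by lia⟩).2 h).le)
  refine ⟨k, n - q, by lia, fun i => ?_⟩
  simp only [fhmVec_apply (show k + (n - q) ≤ n by lia), Nat.sub_sub_self hq, ← hpos, ← hnonneg]
  rcases lt_trichotomy (c i) 0 with h | h | h
  · rw [if_neg h.not_gt, if_neg h.not_ge, sign_neg h, SignType.coe_neg_one]
  · rw [if_neg h.not_gt, if_pos h.ge, h, sign_zero, SignType.coe_zero]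
  · rw [if_pos h, sign_pos h, SignType.coe_one]

theorem exists_supportFace_subset_fhmFace {c : Fin n → ℝ} (hc : Antitone c) (hc0 : c ≠ 0) :
    ∃ k l, 1 ≤ k + l ∧ k + l ≤ n ∧ supportFace c ⊆ fhmFace n k l := by
  obtain ⟨k, l, hkl, hsign⟩ := exists_fhmVec_eq_sign hc
  refine ⟨k, l, ?_, hkl, supportFace_fhmVec hkl ▸ supportFace_subset_supportFace fun u v _ h => ?_⟩
  · obtain ⟨i, hi : c i ≠ 0⟩ := Function.ne_iff.1 hc0
    refine (fhmVec_ne_zero_iff hkl).1 (Function.ne_iff.2 ⟨i, ?_⟩)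
    rw [hsign]
    rcases lt_or_gt_of_ne hi with hi | hi <;> simp [sign_neg, sign_pos, hi]
  · rw [hsign, hsign] at h ⊢
    rcases lt_trichotomy (c u) 0 with hu | hu | hu <;>
      rcases lt_trichotomy (c v) 0 with hv | hv | hv <;>
      simp [sign_neg, sign_pos, hu, hv] at h ⊢ <;> linarith

theorem eq_zero_of_pairwise_add_eq_zero {ι : Type*} {s : Set ι} {w : ι → ℝ}
    (hw : s.Pairwise fun i j => w i + w j = 0) {a b c : ι} (ha : a ∈ s) (hb : b ∈ s) (hc : c ∈ s)
    (hab : a ≠ b) (hac : a ≠ c) (hbc : b ≠ c) {i : ι} (hi : i ∈ s) : w i = 0 := by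
  have hwa : w a = 0 := by linarith [hw ha hb hab, hw ha hc hac, hw hb hc hbc]
  rcases eq_or_ne i a with rfl | hia
  · exact hwa
  · linarith [hw hi ha hia]

/-- Two of the middle coordinates, on which `fhmVec` vanishes, have opposite values under `w`, so
all of them are `0` as soon as there are three. -/
theorem eq_zero_of_mem_constFunctionals_fhmFace (h : k + l + 3 ≤ n) {w : Fin n → ℝ}
    (hw : w ∈ constFunctionals (fhmFace n k l)) {i : Fin n} (hki : k ≤ (i : ℕ))
    (hil : (i : ℕ) < n - l) : w i = 0 := by
  rw [← supportFace_fhmVec (by lia)] at hw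
  let s : Set (Fin n) := {i | k ≤ (i : ℕ) ∧ (i : ℕ) < n - l}
  have hzero {i : Fin n} (hi : i ∈ s) : fhmVec n k l i = 0 := by
    rw [fhmVec_apply (by lia), if_neg (not_lt.2 hi.1), if_pos hi.2]
  have hlt {i j : Fin n} (hi : i ∈ s) (hj : j ∈ s) (hij : i < j) : w i + w j = 0 :=
    add_eq_zero_of_mem_constFunctionals_supportFace (antitone_fhmVec n k l) hij
      (by rw [hzero hi, hzero hj, add_zero]) hw
  have hpair : s.Pairwise fun i j => w i + w j = 0 := fun i hi j hj hij =>
    hij.lt_or_gt.elim (hlt hi hj) fun hji => (add_comm _ _).trans (hlt hj hi hji)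
  refine eq_zero_of_pairwise_add_eq_zero hpair (a := ⟨k, by lia⟩) (b := ⟨k + 1, by lia⟩)
    (c := ⟨k + 2, by lia⟩) ?_ ?_ ?_ ?_ ?_ ?_ ⟨hki, hil⟩ <;>
  first | exact ⟨by simp, by simp only; lia⟩ | simp

theorem FacetPair.one_le_add (h : FacetPair n k l) : 1 ≤ k + l := by
  unfold FacetPair at h
  lia

theorem FacetPair.add_le (hn : 3 ≤ n) (h : FacetPair n k l) : k + l ≤ n := by
  unfold FacetPair at h
  lia
theorem constFunctionals_fhmFace_le (hn : 4 ≤ n) (hkl : FacetPair n k l) :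
    constFunctionals (fhmFace n k l) ≤ ℝ ∙ fhmVec n k l := by
  have h : k + l ≤ n := hkl.add_le (by lia)
  unfold FacetPair at hkl
  intro w hw
  have hends {i j : Fin n} (hi : (i : ℕ) < k) (hj : n - l ≤ (j : ℕ)) : w i = -w j := by
    refine eq_neg_of_add_eq_zero_left (add_eq_zero_of_mem_constFunctionals_supportFace
      (antitone_fhmVec n k l) (by lia) ?_ (supportFace_fhmVec h ▸ hw))
    rw [fhmVec_apply h, fhmVec_apply h, if_pos hi, if_neg (by lia), if_neg (by lia), add_neg_cancel]
  obtain ⟨r, hfirst, hlast⟩ : ∃ r : ℝ, (∀ i : Fin n, (i : ℕ) < k → w i = r) ∧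
      ∀ j : Fin n, n - l ≤ (j : ℕ) → w j = -r := by
    obtain rfl | hl : l = 0 ∨ 0 < l := by lia
    · exact ⟨w ⟨0, by lia⟩, fun i hi => congrArg w (Fin.ext (by lia)), fun j hj => by lia⟩
    · refine ⟨-w ⟨n - 1, by lia⟩, fun i hi => hends hi (by lia), fun j hj => ?_⟩
      obtain rfl | hk : k = 0 ∨ 0 < k := by lia
      · rw [neg_neg]
        exact congrArg w (Fin.ext (by lia))
      · rw [neg_neg, ← neg_inj, ← hends (i := ⟨0, by lia⟩) hk hj]
        exact hends hk (by lia)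
  refine Submodule.mem_span_singleton.2 ⟨r, funext fun i => ?_⟩
  rw [Pi.smul_apply, fhmVec_apply h, smul_eq_mul]
  split_ifs with hk hl
  · rw [hfirst i hk, mul_one]
  · rw [eq_zero_of_mem_constFunctionals_fhmFace (by lia) hw (not_lt.1 hk) hl, mul_zero]
  · rw [hlast i (not_lt.1 hl), mul_neg_one]

theorem isFacet_fhmFace (hn : 4 ≤ n) (hkl : FacetPair n k l) :
    IsFacet (degreePartitionPolytope n) (fhmFace n k l) :=
  have h : k + l ≤ n := hkl.add_le (by lia)
  isFacet_tightSet (affineDim_degreePartitionPolytope (by lia))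
    ((fhmVec_ne_zero_iff h).2 hkl.one_le_add) (fhmVec_dotProduct_le h)
    ⟨_, supportFace_fhmVec h ▸ degVec_splitGraph_mem_supportFace_fhmVec h⟩
    (constFunctionals_fhmFace_le hn hkl)

theorem exists_fhmFace_subset_of_not_facetPair (h0 : 1 ≤ k + l) (h : k + l ≤ n)
    (hkl : ¬ FacetPair n k l) :
    ∃ k' l', 1 ≤ k' + l' ∧ k' + l' ≤ n ∧ (k, l) ≠ (k', l') ∧ fhmFace n k l ⊆ fhmFace n k' l' := by
  obtain ⟨k', l', hkl'⟩ : ∃ k' l', 2 ≤ k ∧ l = 0 ∧ k' = 1 ∧ l' = 0 ∨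
      k = 0 ∧ 2 ≤ l ∧ k' = 0 ∧ l' = 1 ∨
      k ≠ 0 ∧ l ≠ 0 ∧ k + l + 1 = n ∧ k' = k + 1 ∧ l' = l ∨
      k ≠ 0 ∧ l ≠ 0 ∧ k + l + 2 = n ∧ k' = k + 1 ∧ l' = l + 1 := by
    have hcases : 2 ≤ k ∧ l = 0 ∨ k = 0 ∧ 2 ≤ l ∨
        k ≠ 0 ∧ l ≠ 0 ∧ (k + l + 1 = n ∨ k + l + 2 = n) := by
      unfold FacetPair at hkl
      lia
    rcases hcases with _ | _ | ⟨_, _, _ | _⟩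
    exacts [⟨1, 0, by lia⟩, ⟨0, 1, by lia⟩, ⟨k + 1, l, by lia⟩, ⟨k + 1, l + 1, by lia⟩]
  have h' : k' + l' ≤ n := by lia
  refine ⟨k', l', by lia, h', by grind, ?_⟩
  rw [← supportFace_fhmVec h, ← supportFace_fhmVec h']
  refine supportFace_subset_supportFace fun u v huv hne => ?_
  rw [fhmVec_apply h', fhmVec_apply h'] at hne ⊢
  rw [fhmVec_apply h, fhmVec_apply h]
  split_ifs at hne ⊢ <;> first | lia | (exfalso; norm_num at hne; done) | norm_num

theorem eq_of_fhmFace_subset (hn : 3 ≤ n) {k' l' : ℕ} (h : k + l ≤ n) (h0' : 1 ≤ k' + l')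
    (h' : k' + l' ≤ n) (hF : IsFacet (degreePartitionPolytope n) (fhmFace n k l))
    (hsub : fhmFace n k l ⊆ fhmFace n k' l') : (k, l) = (k', l') := by
  obtain ⟨r, hr, hvec⟩ := hF.exists_pos_smul_eq (affineDim_degreePartitionPolytope hn)
    (fhmVec_dotProduct_le h) (fhmVec_dotProduct_le h') ((fhmVec_ne_zero_iff h').2 h0') hsub
  have hval (i : Fin n) : fhmVec n k l i = r • fhmVec n k' l' i := congrFun hvec i
  have hfirst (i : Fin n) : (i : ℕ) < k ↔ (i : ℕ) < k' := by
    rw [← fhmVec_pos_iff h, ← fhmVec_pos_iff h', hval, smul_pos_iff_of_pos_left hr]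
  have hlast (i : Fin n) : n - l ≤ (i : ℕ) ↔ n - l' ≤ (i : ℕ) := by
    rw [← fhmVec_neg_iff h, ← fhmVec_neg_iff h', hval, smul_neg_iff_of_pos_left hr]
  refine Prod.ext ?_ ?_
  · by_contra! hne
    have := hfirst ⟨min k k', by grind⟩
    grind
  · by_contra! hne
    have := hlast ⟨n - 1 - min l l', by grind⟩
    grind

theorem facetPair_of_isFacet (hn : 3 ≤ n) (h0 : 1 ≤ k + l) (h : k + l ≤ n)
    (hF : IsFacet (degreePartitionPolytope n) (fhmFace n k l)) : FacetPair n k l := by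
  by_contra hkl
  obtain ⟨k', l', h0', h', hne, hsub⟩ := exists_fhmFace_subset_of_not_facetPair h0 h hkl
  exact hne (eq_of_fhmFace_subset hn h h0' h' hF hsub)

end FHM

/-! ### Classification and count -/

section Classification

open Finset.HasAntidiagonal (antidiagonal mem_antidiagonal)

variable {n : ℕ} {i j : Fin n}

theorem isFacet_iff (hn : 4 ≤ n) {F : Set (Fin n → ℝ)} :
    IsFacet (degreePartitionPolytope n) F ↔
      (∃ i j : Fin n, (j : ℕ) = i + 1 ∧ F = tieFace i j) ∨
        ∃ k l, FacetPair n k l ∧ F = fhmFace n k l := by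
  have hP : affineDim (degreePartitionPolytope n) = n :=
    affineDim_degreePartitionPolytope (by lia)
  constructor
  · intro hF
    obtain ⟨c, hc0, hFc⟩ := hF.exists_functional
    by_cases hc : Antitone c
    · obtain ⟨k, l, h0, h, hsub⟩ := exists_supportFace_subset_fhmFace hc hc0
      have hFeq : F = fhmFace n k l :=
        hF.eq_tightSet_of_subset hP ((fhmVec_ne_zero_iff h).2 h0) fun x hx =>
          have hx := hFc ▸ hx
          hsub (mem_supportFace_of_forall_le hc hx.1 hx.2)
      exact Or.inr ⟨k, l, facetPair_of_isFacet (by lia) h0 h (hFeq ▸ hF), hFeq⟩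
    · obtain ⟨i, j, hij, htie⟩ := exists_tie_of_not_antitone hc
      have hne : i ≠ j := by
        rintro rfl
        lia
      exact Or.inl ⟨i, j, hij, hF.eq_tightSet_of_subset hP (tieVec_ne_zero hne) fun x hx =>
        have hx := hFc ▸ hx
        mem_tieFace.2 ⟨hx.1, htie x hx.1 hx.2⟩⟩
  · rintro (⟨i, j, hij, rfl⟩ | ⟨k, l, hkl, rfl⟩)
    · exact isFacet_tieFace (by lia) hij
    · exact isFacet_fhmFace hn hkl

theorem isFacet_fhmFace_iff (hn : 4 ≤ n) {k l : ℕ} (h0 : 1 ≤ k + l) (h : k + l ≤ n) :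
    IsFacet (degreePartitionPolytope n) (fhmFace n k l) ↔ FacetPair n k l :=
  ⟨facetPair_of_isFacet (by lia) h0 h, isFacet_fhmFace hn⟩

theorem tieVec_pos_iff {u : Fin n} (hij : i ≠ j) : 0 < tieVec i j u ↔ u = j := by
  rw [tieVec, Pi.sub_apply, Pi.single_apply, Pi.single_apply]
  split_ifs <;> simp_all

theorem eq_of_tieFace_subset (hn : 3 ≤ n) {i' j' : Fin n} (hij : (j : ℕ) = i + 1)
    (hij' : i' < j') (hsub : tieFace i j ⊆ tieFace i' j') : j = j' := by
  have hlt : i < j := by lia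
  obtain ⟨r, hr, hvec⟩ := (isFacet_tieFace hn hij).exists_pos_smul_eq
    (affineDim_degreePartitionPolytope hn) (tieVec_dotProduct_nonpos hlt.le)
    (tieVec_dotProduct_nonpos hij'.le) (tieVec_ne_zero hij'.ne) hsub
  have hj := (tieVec_pos_iff hlt.ne).2 (Eq.refl j)
  rwa [hvec, Pi.smul_apply, smul_pos_iff_of_pos_left hr, tieVec_pos_iff hij'.ne] at hj

theorem not_antitone_tieVec (hij : i < j) : ¬ Antitone (tieVec i j) := by
  intro h
  have hi := ((tieVec_pos_iff hij.ne).2 rfl).trans_le (h hij.le)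
  exact hij.ne ((tieVec_pos_iff hij.ne).1 hi)

theorem tieFace_ne_fhmFace (hn : 3 ≤ n) (hij : (j : ℕ) = i + 1) {k l : ℕ}
    (hkl : FacetPair n k l) : tieFace i j ≠ fhmFace n k l := by
  intro heq
  have hlt : i < j := by lia
  obtain ⟨r, hr, hvec⟩ := (isFacet_tieFace hn hij).exists_pos_smul_eq
    (affineDim_degreePartitionPolytope hn) (tieVec_dotProduct_nonpos hlt.le)
    (fhmVec_dotProduct_le (hkl.add_le hn))
    ((fhmVec_ne_zero_iff (hkl.add_le hn)).2 hkl.one_le_add) heq.subset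
  exact not_antitone_tieVec hlt (hvec ▸ (antitone_fhmVec n k l).const_smul hr.le)

theorem injOn_fhmFace (hn : 4 ≤ n) :
    Set.InjOn (fun p : ℕ × ℕ => fhmFace n p.1 p.2) {p | FacetPair n p.1 p.2} := by
  intro p (hp : FacetPair n p.1 p.2) q (hq : FacetPair n q.1 q.2) hpq
  exact eq_of_fhmFace_subset (by lia) (hp.add_le (by lia)) hq.one_le_add (hq.add_le (by lia))
    (isFacet_fhmFace hn hp) hpq.subset

theorem card_biUnion_antidiagonal (s : Finset ℕ) :
    (s.biUnion antidiagonal).card = ∑ m ∈ s, (m + 1) := by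
  rw [Finset.card_biUnion]
  · simp only [Finset.Nat.card_antidiagonal]
  · intro a _ b _ hab
    refine Finset.disjoint_left.2 fun p ha hb => hab ?_
    rw [← mem_antidiagonal.1 ha, mem_antidiagonal.1 hb]

/-- The set of pairs `(k, l)` with `FacetPair n k l` (for `n ≥ 2`) as a finset, arranged for
counting: the pairs with `k, l ≠ 0` are shifted by `(1, 1)` to run over whole antidiagonals. -/
def facetPairs (n : ℕ) : Finset (ℕ × ℕ) :=
  {(1, 0), (0, 1)} ∪ ((insert (n - 2) (Finset.range (n - 4))).biUnion
    antidiagonal).image (Prod.map (· + 1) (· + 1))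

theorem mem_facetPairs (hn : 2 ≤ n) {k l : ℕ} : (k, l) ∈ facetPairs n ↔ FacetPair n k l := by
  simp only [facetPairs, FacetPair, Finset.mem_union, Finset.mem_insert, Finset.mem_singleton,
    Finset.mem_image, Finset.mem_biUnion, mem_antidiagonal, Finset.mem_range,
    Prod.mk.injEq, Prod.exists, Prod.map_apply, or_assoc]
  refine or_congr_right (or_congr_right ⟨?_, ?_⟩)
  · rintro ⟨a, b, hab, rfl, rfl⟩
    lia
  · intro h
    exact ⟨k - 1, l - 1, ⟨k - 1 + (l - 1), by lia, rfl⟩, by lia, by lia⟩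

theorem card_facetPairs (hn : 4 ≤ n) : (facetPairs n).card = n + 1 + (n - 3).choose 2 := by
  have hinj : (Prod.map (· + 1) (· + 1) : ℕ × ℕ → ℕ × ℕ).Injective :=
    (add_left_injective 1).prodMap (add_left_injective 1)
  have hgauss : ∑ m ∈ Finset.range (n - 4), (m + 1) = (n - 3).choose 2 := by
    rw [Nat.choose_two_right, ← Finset.sum_range_id, show n - 3 = n - 4 + 1 by lia,
      Finset.sum_range_succ', add_zero]
  rw [facetPairs, Finset.card_union_of_disjoint, Finset.card_image_of_injective _ hinj,
    card_biUnion_antidiagonal, Finset.sum_insert, hgauss, Finset.card_pair]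
  · lia
  · simp
  · rw [Finset.mem_range]
    lia
  · simp [Finset.disjoint_left]

theorem setOf_isFacet (hn : 4 ≤ n + 1) :
    {F | IsFacet (degreePartitionPolytope (n + 1)) F} =
      Set.range (fun i : Fin n => tieFace i.castSucc i.succ) ∪
        (fun p : ℕ × ℕ => fhmFace (n + 1) p.1 p.2) '' facetPairs (n + 1) := by
  ext F
  rw [Set.mem_ofPred_eq, isFacet_iff hn]
  refine or_congr ⟨?_, ?_⟩ ?_
  · rintro ⟨i, j, hij, rfl⟩
    exact ⟨⟨i, by lia⟩, congrArg (tieFace i) (Fin.ext hij.symm)⟩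
  · rintro ⟨i, rfl⟩
    exact ⟨i.castSucc, i.succ, by simp, rfl⟩
  · simp [mem_facetPairs (show 2 ≤ n + 1 by lia), eq_comm]

theorem ncard_setOf_isFacet (hn : 4 ≤ n) :
    {F | IsFacet (degreePartitionPolytope n) F}.ncard = n - 1 + (n + 1 + (n - 3).choose 2) := by
  obtain ⟨m, rfl⟩ := Nat.exists_eq_add_one.2 (show 0 < n by lia)
  have hpairs : ∀ p ∈ facetPairs (m + 1), FacetPair (m + 1) p.1 p.2 :=
    fun p => (mem_facetPairs (by lia)).1
  have htie : Function.Injective fun i : Fin m => tieFace i.castSucc i.succ := fun i i' h =>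
    Fin.succ_injective m
      (eq_of_tieFace_subset (by lia) (by simp) i'.castSucc_lt_succ h.subset)
  rw [setOf_isFacet hn, Set.ncard_union_eq, Set.ncard_range_of_injective htie, Nat.card_fin,
    ((injOn_fhmFace hn).mono hpairs).ncard_image, Set.ncard_coe_finset, card_facetPairs hn,
    Nat.add_sub_cancel]
  · refine Set.disjoint_left.2 ?_
    rintro _ ⟨i, rfl⟩ ⟨p, hp, h⟩
    exact tieFace_ne_fhmFace (by lia) (by simp) (hpairs p hp) h.symm

end Classification

theorem mainTheorem3 (n : ℕ) (hn : 4 ≤ n) :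
    -- the inequalities are valid on the polytope
    (∀ x ∈ degreePartitionPolytope n, ∀ i j : Fin n, (j : ℕ) = i + 1 → x i ≥ x j) ∧
    (∀ x ∈ degreePartitionPolytope n, ∀ k l : ℕ, 1 ≤ k + l → k + l ≤ n →
      fhmLhs n k l x ≤ fhmRhs n k l) ∧
    -- the facets are exactly the faces cut out by the listed inequalities
    (∀ F : Set (Fin n → ℝ), IsFacet (degreePartitionPolytope n) F ↔
      ((∃ i j : Fin n, (j : ℕ) = i + 1 ∧ F = {x ∈ degreePartitionPolytope n | x i = x j}) ∨
        (∃ k l : ℕ, FacetPair n k l ∧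
          F = {x ∈ degreePartitionPolytope n | fhmLhs n k l x = fhmRhs n k l}))) ∧
    -- among all the FHM inequalities, exactly the listed ones determine facets
    (∀ k l : ℕ, 1 ≤ k + l → k + l ≤ n →
      (IsFacet (degreePartitionPolytope n)
          {x ∈ degreePartitionPolytope n | fhmLhs n k l x = fhmRhs n k l} ↔
        FacetPair n k l)) ∧
    -- the number of facets
    ({F : Set (Fin n → ℝ) | IsFacet (degreePartitionPolytope n) F}.ncard : ℚ) =
      (n : ℚ) * ((n : ℚ) - 3) / 2 + 6 := by
  simp only [← tieFace_eq_setOf, ← fhmFace_eq_setOf]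
  refine ⟨fun x hx i j hij => antitone_of_mem_degreePartitionPolytope hx (by lia),
    fun x hx k l _ h => (fhmLhs_eq_dotProduct n k l x).trans_le (fhmVec_dotProduct_le h x hx),
    fun F => isFacet_iff hn, fun k l h0 h => isFacet_fhmFace_iff hn h0 h, ?_⟩
  rw [ncard_setOf_isFacet hn]
  push_cast [Nat.cast_choose_two, show 1 ≤ n by lia, show 3 ≤ n by lia]
  ring
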